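/- Let $n\ge 3$ be an integer. There is a constant $C$, depending only on $n$, such that the following holds for every prime power $q$. Consider the projective space $\mathrm{PG}(2n,q)$; an $i$-space is a subspace of projective dimension $i$. An $(n-1,n)$-flag is a pair $(A,B)$ of an $(n-1)$-space $A$ and an $n$-space $B$ with $A\subseteq B$. Let $\Gamma_{2n}$ be the graph whose vertices are the $(n-1,n)$-flags, two flags $(A_1,B_1)$ and $(A_2,B_2)$ being adjacent if they are opposite, that is, if $A_1\cap B_2=A_2\cap B_1=\emptyset$. Let $\mathcal F$ be a maximal coclique of $\Gamma_{2n}$, that is, an independent set that is maximal with respect to inclusion. Call an $(n-1)$-space or an $n$-space red if it occurs in exactly $\frac{q^{n+1}-1}{q-1}$ flags of $\mathcal F$. Then: (1) either the number of red $(n-1)$-spaces is at most $C q^{n^2-2}$, or there is a point $P$ such that every $(n-1)$-space through $P$ is red; (2) either the number of red $n$-spaces is at most $C q^{n^2-2}$, or there is a hyperplane $H$ such that every $n$-space contained in $H$ is red. In both parts "or" is inclusive. -/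

import Mathlib

/-- The Gaussian coefficient `[b choose a]_q`: the product of `(q^(b-a+i) - 1) / (q^i - 1)` over
`1 ≤ i ≤ a` if `a ≤ b`, and `0` otherwise. -/
def gaussCoeff (q b a : ℕ) : ℚ :=
  if a ≤ b then ∏ i ∈ Finset.Icc 1 a, ((q : ℚ) ^ (b - a + i) - 1) / ((q : ℚ) ^ i - 1) else 0

/-- Projective dimension of a subspace of the projective space of `V`. The subspaces of `PG(V)` are
modelled by the linear subspaces of `V`; the empty one is `⊥`, of projective dimension `-1`. -/
noncomputable def projDim {K V : Type*} [Field K] [AddCommGroup V] [Module K V]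
    (U : Submodule K V) : ℤ :=
  (Module.finrank K U : ℤ) - 1

/-- An `(n-1,n)`-flag of the projective space of `V`: an `(n-1)`-space contained in an
`n`-space. -/
@[ext]
structure PGFlag (K V : Type*) [Field K] [AddCommGroup V] [Module K V] (n : ℕ) where
  /-- the `(n-1)`-space of the flag -/
  lower : Submodule K V
  /-- the `n`-space of the flag -/
  upper : Submodule K V
  projDim_lower : projDim lower = (n : ℤ) - 1
  projDim_upper : projDim upper = (n : ℤ)
  le : lower ≤ upper

/-- Two flags `(A₁,B₁)` and `(A₂,B₂)` are opposite if `A₁ ∩ B₂` and `A₂ ∩ B₁` are both empty. -/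
def PGFlag.Opposite {K V : Type*} [Field K] [AddCommGroup V] [Module K V] {n : ℕ}
    (f g : PGFlag K V n) : Prop :=
  f.lower ⊓ g.upper = ⊥ ∧ g.lower ⊓ f.upper = ⊥

/-- The graph on the `(n-1,n)`-flags in which two flags are adjacent if they are opposite.
The condition `f ≠ g` follows from being opposite when `1 ≤ n`, see `flagGraph_adj_iff`. -/
def flagGraph (K V : Type*) [Field K] [AddCommGroup V] [Module K V] (n : ℕ) :
    SimpleGraph (PGFlag K V n) where
  Adj f g := f ≠ g ∧ f.Opposite g
  symm := ⟨fun _ _ h => ⟨h.1.symm, h.2.2, h.2.1⟩⟩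
  loopless := ⟨fun _ h => h.1 rfl⟩

theorem flagGraph_adj_iff {K V : Type*} [Field K] [AddCommGroup V] [Module K V] {n : ℕ}
    (hn : 1 ≤ n) (f g : PGFlag K V n) : (flagGraph K V n).Adj f g ↔ f.Opposite g := by
  refine ⟨fun h => h.2, fun h => ⟨?_, h⟩⟩
  rintro rfl
  have h1 : f.lower = ⊥ := by
    have h2 := h.1
    rwa [inf_eq_left.mpr f.le] at h2
  have h3 := f.projDim_lower
  rw [h1] at h3
  simp only [projDim, finrank_bot] at h3
  omega

/-- A maximal (with respect to inclusion) coclique of the graph of flags. -/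
def IsMaximalCoclique {K V : Type*} [Field K] [AddCommGroup V] [Module K V] {n : ℕ}
    (F : Set (PGFlag K V n)) : Prop :=
  Maximal (flagGraph K V n).IsIndepSet F

/-- The `(n-1)`-space `A` is red with respect to `F`: it occurs in exactly `[n+1 choose 1]_q` flags
of `F`, where `q` is the order of the ground field. -/
def IsRedLower {K V : Type*} [Field K] [AddCommGroup V] [Module K V] {n : ℕ}
    (F : Set (PGFlag K V n)) (A : Submodule K V) : Prop :=
  projDim A = (n : ℤ) - 1 ∧
    (({f ∈ F | f.lower = A}.ncard : ℕ) : ℚ) = gaussCoeff (Nat.card K) (n + 1) 1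

/-- The `n`-space `B` is red with respect to `F`: it occurs in exactly `[n+1 choose 1]_q` flags
of `F`, where `q` is the order of the ground field. -/
def IsRedUpper {K V : Type*} [Field K] [AddCommGroup V] [Module K V] {n : ℕ}
    (F : Set (PGFlag K V n)) (B : Submodule K V) : Prop :=
  projDim B = (n : ℤ) ∧
    (({f ∈ F | f.upper = B}.ncard : ℕ) : ℚ) = gaussCoeff (Nat.card K) (n + 1) 1

/-! An `(n-1)`-space lies in exactly `[n+1 choose 1]_q` flags, so it is red iff all its flags lie in
`F`. Two disjoint red `(n-1)`-spaces would carry opposite flags of `F`. The red ones thus form an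
intersecting family of `n`-dimensional subspaces in dimension `2n+1`, and `card_le_or_exists_point`
says that it has size `O(q^(n^2-2))` or a common point `P`.

In the second case suppose some `A` through `P` is not red. By maximality a flag of `A` outside `F`
is opposite to some `g` in `F`. Then `g.upper` misses `A`, hence `P`, while every red space must
meet `g.upper`. By `card_le_of_point_of_inf_ne_bot` only `O(q^(n^2-2))` subspaces through `P` do so.

Part (2) is part (1) in the dual space, since taking annihilators is an isomorphism of the flag
graphs that swaps the two members of a flag. -/

/-! ### Counting in families of subspaces -/

open scoped Classical in
/-- The number of vectors of `A` outside a subspace `S` of `A`. -/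
theorem card_mem_notMem {K V : Type*} [Field K] [Finite K] [AddCommGroup V] [Module K V]
    [Fintype V] {S A : Submodule K V} (h : S ≤ A) :
    (Finset.univ.filter fun v : V => v ∈ A ∧ v ∉ S).card =
      Nat.card K ^ Module.finrank K A - Nat.card K ^ Module.finrank K S := by
  have card_mem : ∀ W : Submodule K V, (Finset.univ.filter fun v : V => v ∈ W).card =
      Nat.card K ^ Module.finrank K W := by
    intro W
    rw [← Module.natCard_eq_pow_finrank (K := K) (V := W), ← Nat.subtype_card]
    simp
  rw [← card_mem, ← card_mem, ← Finset.card_sdiff_of_subset]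
  · congr 1
    ext v
    simp
  · intro v
    simpa using fun hv => h hv

open scoped Classical in
/-- If every member of `R` meets `W` nontrivially, and at most `M` members of `R` contain any given
nonzero vector of `W`, then `R` has at most `2 q ^ (dim W - 1) * M` members. -/
theorem card_le_of_inf_ne_bot {K V : Type*} [Field K] [Finite K] [AddCommGroup V] [Module K V]
    [Finite V] {W : Submodule K V} {w M : ℕ} (hw : Module.finrank K W = w + 1)
    {R : Finset (Submodule K V)} (hR : ∀ A ∈ R, A ⊓ W ≠ ⊥)
    (hM : ∀ v ∈ W, v ≠ 0 → (R.filter fun A => v ∈ A).card ≤ M) :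
    R.card ≤ 2 * Nat.card K ^ w * M := by
  have := Fintype.ofFinite V
  have hq : 2 ≤ Nat.card K := Finite.one_lt_card
  have key := Finset.card_mul_le_card_mul (fun (A : Submodule K V) (v : V) => v ∈ A)
    (s := R) (t := Finset.univ.filter fun v : V => v ∈ W ∧ v ∉ (⊥ : Submodule K V))
    (m := Nat.card K - 1) (n := M) ?_ ?_
  · rw [card_mem_notMem bot_le, hw, finrank_bot, pow_zero] at key
    obtain ⟨p, hp⟩ : ∃ p, Nat.card K = p + 2 := ⟨_, (Nat.sub_add_cancel hq).symm⟩
    -- The factor 2 absorbs `q / (q - 1)`.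
    have h1 : Nat.card K ^ (w + 1) - 1 ≤ 2 * Nat.card K ^ w * (Nat.card K - 1) := by
      rw [hp, pow_succ, show p + 2 - 1 = p + 1 by omega]
      have : 0 ≤ p * (p + 2) ^ w := Nat.zero_le _
      refine (Nat.sub_le _ _).trans ?_
      nlinarith
    have h2 := key.trans (Nat.mul_le_mul_right M h1)
    refine Nat.le_of_mul_le_mul_right (c := Nat.card K - 1) ?_ (by omega)
    linarith
  · intro A hA
    have h1 : Finset.bipartiteAbove (fun (A : Submodule K V) (v : V) => v ∈ A)
        (Finset.univ.filter fun v : V => v ∈ W ∧ v ∉ (⊥ : Submodule K V)) A =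
        Finset.univ.filter fun v : V => v ∈ A ⊓ W ∧ v ∉ (⊥ : Submodule K V) := by
      ext v
      simp [Finset.bipartiteAbove, Submodule.mem_inf]
      tauto
    rw [h1, card_mem_notMem bot_le, finrank_bot, pow_zero]
    have h2 : 1 ≤ Module.finrank K (A ⊓ W : Submodule K V) :=
      Submodule.one_le_finrank_iff.mpr (hR A hA)
    exact Nat.sub_le_sub_right (Nat.le_self_pow (by omega) _) 1
  · intro v hv
    simp only [Finset.mem_filter, Finset.mem_univ, true_and, Submodule.mem_bot] at hv
    exact hM v hv.1 hv.2

/-- A bound for the number of `k`-dimensional subspaces through a given subspace. -/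
theorem card_le_of_forall_le {K V : Type*} [Field K] [Finite K] [AddCommGroup V] [Module K V]
    [Finite V] {k c : ℕ} (hV : Module.finrank K V = k + c) (i : ℕ) {S : Submodule K V}
    (hS : Module.finrank K S + i = k) {R : Finset (Submodule K V)}
    (hR : ∀ A ∈ R, S ≤ A ∧ Module.finrank K A = k) :
    R.card ≤ (2 * Nat.card K ^ c) ^ i := by
  classical
  have := Fintype.ofFinite V
  have hq : 2 ≤ Nat.card K := Finite.one_lt_card
  induction i generalizing S R with
  | zero =>
    rw [pow_zero, Finset.card_le_one]
    have h : ∀ A ∈ R, S = A := fun A hA =>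
      Submodule.eq_of_le_of_finrank_eq (hR A hA).1 (by rw [(hR A hA).2, ← hS, add_zero])
    exact fun A hA B hB => (h A hA).symm.trans (h B hB)
  | succ i ih =>
    have key := Finset.card_mul_le_card_mul (fun (A : Submodule K V) (v : V) => v ∈ A)
      (s := R) (t := Finset.univ.filter fun v : V => v ∈ (⊤ : Submodule K V) ∧ v ∉ S)
      (m := Nat.card K ^ k - Nat.card K ^ Module.finrank K S)
      (n := (2 * Nat.card K ^ c) ^ i) ?_ ?_
    · rw [card_mem_notMem le_top, finrank_top, hV] at key
      -- As `dim S < k` and `q ≥ 2`, at least half of the vectors of each member lie outside `S`.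
      have h1 : Nat.card K ^ k ≤
          2 * (Nat.card K ^ k - Nat.card K ^ Module.finrank K S) := by
        have : 2 * Nat.card K ^ Module.finrank K S ≤ Nat.card K ^ k :=
          calc 2 * Nat.card K ^ Module.finrank K S
              ≤ Nat.card K * Nat.card K ^ Module.finrank K S := Nat.mul_le_mul_right _ hq
            _ = Nat.card K ^ (Module.finrank K S + 1) := by rw [pow_succ, mul_comm]
            _ ≤ Nat.card K ^ k := Nat.pow_le_pow_right (by omega) (by omega)
        omega
      refine Nat.le_of_mul_le_mul_right (c := Nat.card K ^ k) ?_ (by positivity)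
      calc R.card * Nat.card K ^ k
          ≤ R.card * (2 * (Nat.card K ^ k - Nat.card K ^ Module.finrank K S)) :=
            Nat.mul_le_mul_left _ h1
        _ = 2 * (R.card * (Nat.card K ^ k - Nat.card K ^ Module.finrank K S)) := by ring
        _ ≤ 2 * (Nat.card K ^ (k + c) * (2 * Nat.card K ^ c) ^ i) :=
            Nat.mul_le_mul_left _ (key.trans (Nat.mul_le_mul_right _ (Nat.sub_le _ _)))
        _ = (2 * Nat.card K ^ c) ^ (i + 1) * Nat.card K ^ k := by ring
    · intro A hA
      rw [← (hR A hA).2, ← card_mem_notMem (hR A hA).1]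
      refine Finset.card_le_card fun v => ?_
      simp [Finset.bipartiteAbove]
      tauto
    · intro v hv
      simp only [Finset.mem_filter, Finset.mem_univ, true_and, Submodule.mem_top] at hv
      refine ih (S := S ⊔ Submodule.span K {v}) ?_ ?_
      · rw [Submodule.finrank_sup_span_singleton hv]
        omega
      · intro A hA
        rw [Finset.bipartiteBelow, Finset.mem_filter] at hA
        refine ⟨sup_le (hR A hA.1).1 ?_, (hR A hA.1).2⟩
        simpa using hA.2

/-- In an intersecting family of `k`-dimensional subspaces that is not covered by any subspace of
dimension less than `t`, few members pass through a given subspace of dimension at most `t`. -/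
theorem card_le_of_intersecting_of_forall_le {K V : Type*} [Field K] [Finite K] [AddCommGroup V]
    [Module K V] [Finite V] {k c t : ℕ} (hV : Module.finrank K V = k + 1 + c) (ht : t ≤ k + 1)
    {R : Finset (Submodule K V)} (hk : ∀ A ∈ R, Module.finrank K A = k + 1)
    (hR : ∀ A ∈ R, ∀ B ∈ R, A ⊓ B ≠ ⊥)
    (hcov : ∀ T : Submodule K V, Module.finrank K T < t → ∃ A ∈ R, A ⊓ T = ⊥)
    (i : ℕ) {S : Submodule K V} (hS : Module.finrank K S + i = t)
    {R' : Finset (Submodule K V)} (hR' : ∀ A ∈ R', S ≤ A ∧ A ∈ R) :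
    R'.card ≤ (2 * Nat.card K ^ k) ^ i * (2 * Nat.card K ^ c) ^ (k + 1 - t) := by
  classical
  induction i generalizing S R' with
  | zero =>
    rw [pow_zero, one_mul]
    exact card_le_of_forall_le hV _ (S := S) (by omega) fun A hA =>
      ⟨(hR' A hA).1, hk A (hR' A hA).2⟩
  | succ i ih =>
    -- `B` misses `S`, yet every member through `S` meets `B`: branching over the vectors of `B`
    -- costs `2 q ^ k` and enlarges `S` by one dimension.
    obtain ⟨B, hB, hBS⟩ := hcov S (by omega)
    rw [pow_succ', mul_assoc]
    refine card_le_of_inf_ne_bot (hk B hB) (fun A hA => hR A (hR' A hA).2 B hB) fun v hv hv0 => ?_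
    have hvS : v ∉ S := fun h => hv0 <| by
      have : v ∈ B ⊓ S := ⟨hv, h⟩
      simpa [hBS] using this
    refine ih (S := S ⊔ Submodule.span K {v}) ?_ ?_
    · rw [Submodule.finrank_sup_span_singleton hvS]
      omega
    · intro A hA
      rw [Finset.mem_filter] at hA
      exact ⟨sup_le (hR' A hA.1).1 (by simpa using hA.2), (hR' A hA.1).2⟩

/-- A weak Hilton-Milner theorem for vector spaces: an intersecting family of `n`-dimensional
subspaces of a space of dimension `2 n + 1` is small or all its members share a point. -/
theorem card_le_or_exists_point {K V : Type*} [Field K] [Finite K] [AddCommGroup V]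
    [Module K V] [Finite V] {n : ℕ} (hn : 2 ≤ n) (hV : Module.finrank K V = 2 * n + 1)
    {R : Finset (Submodule K V)} (hk : ∀ A ∈ R, Module.finrank K A = n)
    (hR : ∀ A ∈ R, ∀ B ∈ R, A ⊓ B ≠ ⊥) :
    R.card ≤ 2 ^ n * Nat.card K ^ (n ^ 2 - 2) ∨
      ∃ P : Submodule K V, Module.finrank K P = 1 ∧ ∀ A ∈ R, P ≤ A := by
  classical
  obtain rfl | ⟨A₀, hA₀⟩ := R.eq_empty_or_nonempty
  · simp
  have hex : ∃ t, ∃ T : Submodule K V, Module.finrank K T = t ∧ ∀ A ∈ R, A ⊓ T ≠ ⊥ :=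
    ⟨n, A₀, hk A₀ hA₀, fun A hA => hR A hA A₀ hA₀⟩
  -- `t` is the least dimension of a subspace meeting every member; `t = 1` gives the common point.
  obtain ⟨t, ht⟩ : ∃ t, t = Nat.find hex := ⟨_, rfl⟩
  obtain ⟨T, hT, hTR⟩ := Nat.find_spec hex
  rw [← ht] at hT
  have htn : t ≤ n := ht ▸ Nat.find_le ⟨A₀, hk A₀ hA₀, fun A hA => hR A hA A₀ hA₀⟩
  have hcov : ∀ T : Submodule K V, Module.finrank K T < t → ∃ A ∈ R, A ⊓ T = ⊥ := by
    intro T hT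
    by_contra! h
    exact Nat.find_min hex (ht ▸ hT) ⟨T, rfl, h⟩
  have ht0 : t ≠ 0 := by
    rintro rfl
    exact hTR A₀ hA₀ (by rw [Submodule.finrank_eq_zero.mp hT, inf_bot_eq])
  obtain rfl | ht1 := eq_or_ne t 1
  · refine Or.inr ⟨T, hT, fun A hA => ?_⟩
    rw [← inf_eq_right]
    refine Submodule.eq_of_le_of_finrank_le inf_le_right ?_
    rw [hT]
    exact Submodule.one_le_finrank_iff.mpr (hTR A hA)
  · left
    obtain ⟨k, rfl⟩ : ∃ k, n = k + 1 := ⟨n - 1, by omega⟩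
    obtain ⟨s, rfl⟩ : ∃ s, t = s + 1 := ⟨t - 1, by omega⟩
    obtain ⟨j, rfl⟩ : ∃ j, k = s + j := ⟨k - s, by omega⟩
    have h := card_le_of_inf_ne_bot hT hTR fun v hv hv0 =>
      card_le_of_intersecting_of_forall_le (c := s + j + 2) (by omega) htn hk hR hcov s
        (S := Submodule.span K {v}) (R' := R.filter fun A => v ∈ A)
        (by rw [finrank_span_singleton hv0, add_comm])
        (fun A hA => by
          rw [Finset.mem_filter] at hA
          exact ⟨by simpa using hA.2, hA.1⟩)
    refine h.trans ?_
    rw [show s + j + 1 - (s + 1) = j by omega]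
    -- With `n = s + j + 1` and `t = s + 1` the exponent is `n ^ 2 - t`, which is at most `n ^ 2 -
    -- 2` because `t ≥ 2`.
    have h2 : 2 * Nat.card K ^ s * ((2 * Nat.card K ^ (s + j)) ^ s *
        (2 * Nat.card K ^ (s + j + 2)) ^ j) =
        2 ^ (s + j + 1) * Nat.card K ^ (s + (s + j) * s + (s + j + 2) * j) := by
      simp only [mul_pow, ← pow_mul, pow_add]
      ring
    rw [h2]
    refine Nat.mul_le_mul_left _ (Nat.pow_le_pow_right Nat.card_pos (Nat.le_sub_of_add_le ?_))
    have : 1 ≤ s := by omega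
    nlinarith

/-- Few `n`-dimensional subspaces pass through a point `P` and meet a given subspace of dimension
`n + 1` that does not contain `P`. -/
theorem card_le_of_point_of_inf_ne_bot {K V : Type*} [Field K] [Finite K] [AddCommGroup V]
    [Module K V] [Finite V] {n : ℕ} (hn : 2 ≤ n) (hV : Module.finrank K V = 2 * n + 1)
    {P B : Submodule K V} (hP : Module.finrank K P = 1) (hB : Module.finrank K B = n + 1)
    (hPB : P ⊓ B = ⊥) {R : Finset (Submodule K V)} (hk : ∀ A ∈ R, Module.finrank K A = n)
    (hRP : ∀ A ∈ R, P ≤ A) (hRB : ∀ A ∈ R, A ⊓ B ≠ ⊥) :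
    R.card ≤ 2 ^ n * Nat.card K ^ (n ^ 2 - 2) := by
  classical
  obtain ⟨m, rfl⟩ : ∃ m, n = m + 2 := ⟨n - 2, by omega⟩
  have h := card_le_of_inf_ne_bot hB hRB fun v hv hv0 =>
    card_le_of_forall_le (k := m + 2) (c := m + 3) (by omega) m
      (S := P ⊔ Submodule.span K {v}) (R := R.filter fun A => v ∈ A)
      (by
        rw [Submodule.finrank_sup_span_singleton, hP]
        · omega
        · intro hvP
          have : v ∈ P ⊓ B := ⟨hvP, hv⟩
          rw [hPB] at this
          exact hv0 (by simpa using this))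
      (fun A hA => by
        rw [Finset.mem_filter] at hA
        exact ⟨sup_le (hRP A hA.1) (by simpa using hA.2), hk A hA.1⟩)
  refine h.trans ?_
  -- With `n = m + 2` the exponent is `n + (n + 1) * (n - 2) = n ^ 2 - 2`.
  have h2 : 2 * Nat.card K ^ (m + 2) * (2 * Nat.card K ^ (m + 3)) ^ m =
      2 ^ (m + 1) * Nat.card K ^ (m + 2 + (m + 3) * m) := by
    simp only [mul_pow, ← pow_mul, pow_add]
    ring
  rw [h2]
  refine Nat.mul_le_mul (Nat.pow_le_pow_right (by omega) (by omega))
    (Nat.pow_le_pow_right Nat.card_pos (Nat.le_sub_of_add_le ?_))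
  nlinarith

/-! ### Flags and opposition -/

theorem projDim_eq_sub_one_iff {K V : Type*} [Field K] [AddCommGroup V] [Module K V]
    {U : Submodule K V} {n : ℕ} : projDim U = (n : ℤ) - 1 ↔ Module.finrank K U = n := by
  unfold projDim
  omega

theorem projDim_eq_iff {K V : Type*} [Field K] [AddCommGroup V] [Module K V]
    {U : Submodule K V} {n : ℕ} : projDim U = (n : ℤ) ↔ Module.finrank K U = n + 1 := by
  unfold projDim
  omega

namespace PGFlag

theorem finrank_lower {K V : Type*} [Field K] [AddCommGroup V] [Module K V] {n : ℕ}
    (f : PGFlag K V n) : Module.finrank K f.lower = n :=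
  projDim_eq_sub_one_iff.mp f.projDim_lower

theorem finrank_upper {K V : Type*} [Field K] [AddCommGroup V] [Module K V] {n : ℕ}
    (f : PGFlag K V n) : Module.finrank K f.upper = n + 1 :=
  projDim_eq_iff.mp f.projDim_upper

theorem Opposite.symm {K V : Type*} [Field K] [AddCommGroup V] [Module K V] {n : ℕ}
    {f g : PGFlag K V n} (h : f.Opposite g) : g.Opposite f :=
  ⟨h.2, h.1⟩

instance finite {K V : Type*} [Field K] [AddCommGroup V] [Module K V] [Finite V] {n : ℕ} :
    Finite (PGFlag K V n) :=
  Finite.of_injective (fun f : PGFlag K V n => (f.lower, f.upper)) fun f g h => by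
    rw [Prod.mk.injEq] at h
    exact PGFlag.ext h.1 h.2

/-- The flag spanned by an `(n-1)`-space and a point outside it. -/
def ofNotMem {K V : Type*} [Field K] [AddCommGroup V] [Module K V] [Module.Finite K V] {n : ℕ}
    (A : Submodule K V) (hA : Module.finrank K A = n) (v : V) (hv : v ∉ A) : PGFlag K V n where
  lower := A
  upper := A ⊔ Submodule.span K {v}
  projDim_lower := projDim_eq_sub_one_iff.mpr hA
  projDim_upper := projDim_eq_iff.mpr (by rw [Submodule.finrank_sup_span_singleton hv, hA])
  le := le_sup_left

/-- The number of flags on a given `(n-1)`-space. -/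
theorem ncard_lower_eq {K V : Type*} [Field K] [Finite K] [AddCommGroup V] [Module K V]
    [Finite V] {n : ℕ} (hV : Module.finrank K V = 2 * n + 1) {A : Submodule K V}
    (hA : Module.finrank K A = n) :
    (({f : PGFlag K V n | f.lower = A}.ncard : ℕ) : ℚ) = gaussCoeff (Nat.card K) (n + 1) 1 := by
  classical
  have := Fintype.ofFinite V
  have := Fintype.ofFinite (PGFlag K V n)
  have hq : 2 ≤ Nat.card K := Finite.one_lt_card
  -- Each vector outside `A` lies in the upper space of exactly one flag on `A`.
  have key := Finset.card_mul_eq_card_mul (fun (f : PGFlag K V n) (v : V) => v ∈ f.upper)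
    (s := Finset.univ.filter fun f : PGFlag K V n => f.lower = A)
    (t := Finset.univ.filter fun v : V => v ∈ (⊤ : Submodule K V) ∧ v ∉ A)
    (m := Nat.card K ^ (n + 1) - Nat.card K ^ n) (n := 1) ?_ ?_
  · rw [card_mem_notMem le_top, finrank_top, hV, hA, mul_one] at key
    rw [Set.ncard_eq_toFinset_card', Set.toFinset_ofPred]
    have hle1 : Nat.card K ^ n ≤ Nat.card K ^ (n + 1) :=
      Nat.pow_le_pow_right (by omega) (by omega)
    have hle2 : Nat.card K ^ n ≤ Nat.card K ^ (2 * n + 1) :=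
      Nat.pow_le_pow_right (by omega) (by omega)
    have key' := congrArg (Nat.cast : ℕ → ℚ) key
    push_cast [Nat.cast_sub hle1, Nat.cast_sub hle2] at key'
    have hq' : (2 : ℚ) ≤ Nat.card K := by exact_mod_cast hq
    have hpos : (0 : ℚ) < (Nat.card K : ℚ) ^ n := by positivity
    simp only [gaussCoeff, le_add_iff_nonneg_left, zero_le, if_true, Finset.Icc_self,
      Finset.prod_singleton, Nat.add_sub_cancel, pow_one]
    rw [eq_div_iff (by linarith)]
    refine mul_right_cancel₀ hpos.ne' ?_
    rw [show 2 * n + 1 = n + 1 + n by ring] at key'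
    linear_combination key'
  · intro f hf
    rw [Finset.mem_filter] at hf
    have hc := card_mem_notMem (K := K) (S := A) (A := f.upper) (hf.2 ▸ f.le)
    rw [finrank_upper, hA] at hc
    rw [← hc]
    congr 1
    ext v
    simp [Finset.bipartiteAbove]
    tauto
  · intro v hv
    simp only [Finset.mem_filter, Finset.mem_univ, true_and, Submodule.mem_top] at hv
    rw [Finset.card_eq_one]
    refine ⟨ofNotMem A hA v hv, ?_⟩
    ext f
    simp only [Finset.bipartiteBelow, Finset.mem_filter, Finset.mem_univ, true_and,
      Finset.mem_singleton]
    constructor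
    · rintro ⟨hf, hvf⟩
      refine PGFlag.ext hf (Eq.symm (Submodule.eq_of_le_of_finrank_eq ?_ ?_))
      · exact sup_le (hf ▸ f.le) (by simpa using hvf)
      · rw [finrank_upper, finrank_upper]
    · rintro rfl
      exact ⟨rfl, Submodule.mem_sup_right (Submodule.mem_span_singleton_self v)⟩

/-- `A'` and `A` span only dimension `2n` out of `2n + 1`; adjoining to `A` a vector outside that
span keeps it disjoint from `A'`. -/
theorem exists_lower_eq_of_inf_eq_bot {K V : Type*} [Field K] [AddCommGroup V] [Module K V]
    [Module.Finite K V] {n : ℕ} (hV : Module.finrank K V = 2 * n + 1) {A A' : Submodule K V}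
    (hA : Module.finrank K A = n) (hA' : Module.finrank K A' = n) (h : A' ⊓ A = ⊥) :
    ∃ f : PGFlag K V n, f.lower = A ∧ A' ⊓ f.upper = ⊥ := by
  obtain ⟨v, hv⟩ : ∃ v, v ∉ A' ⊔ A := by
    by_contra! hall
    have h1 : A' ⊔ A = ⊤ := eq_top_iff.mpr fun v _ => hall v
    have h2 := Submodule.finrank_sup_add_finrank_inf_eq A' A
    rw [h1, h, finrank_top, finrank_bot] at h2
    omega
  refine ⟨ofNotMem A hA v fun hvA => hv (Submodule.mem_sup_right hvA), rfl, ?_⟩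
  refine (Disjoint.disjoint_sup_right_of_disjoint_sup_left (disjoint_iff.mpr h) ?_).eq_bot
  exact Submodule.disjoint_span_singleton_of_notMem hv

theorem exists_opposite_lower_eq {K V : Type*} [Field K] [AddCommGroup V] [Module K V]
    [Module.Finite K V] {n : ℕ} (hV : Module.finrank K V = 2 * n + 1) {A : Submodule K V}
    (hA : Module.finrank K A = n) (g : PGFlag K V n) (h : A ⊓ g.upper = ⊥) :
    ∃ f : PGFlag K V n, f.lower = A ∧ f.Opposite g := by
  obtain ⟨f, rfl, hf⟩ := exists_lower_eq_of_inf_eq_bot hV hA g.finrank_lower <| by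
    rw [inf_comm]
    exact le_bot_iff.mp ((inf_le_inf_left A g.le).trans h.le)
  exact ⟨f, rfl, h, hf⟩

end PGFlag

theorem isRedLower_iff {K V : Type*} [Field K] [Finite K] [AddCommGroup V] [Module K V]
    [Finite V] {n : ℕ} (hV : Module.finrank K V = 2 * n + 1) {F : Set (PGFlag K V n)}
    {A : Submodule K V} :
    IsRedLower F A ↔ Module.finrank K A = n ∧ ∀ f : PGFlag K V n, f.lower = A → f ∈ F := by
  rw [IsRedLower, projDim_eq_sub_one_iff]
  refine and_congr_right fun hA => ?_
  rw [← PGFlag.ncard_lower_eq hV hA, Nat.cast_inj]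
  constructor
  · intro h f hf
    have hsub : {f ∈ F | f.lower = A} ⊆ {f | f.lower = A} := fun f hf => hf.2
    have hf' : f ∈ {f ∈ F | f.lower = A} := by
      rw [Set.eq_of_subset_of_ncard_le hsub h.ge]
      exact hf
    exact hf'.1
  · intro h
    congr 1
    ext f
    exact ⟨fun hf => hf.2, fun hf => ⟨h f hf, hf⟩⟩

/-! ### Red spaces of a maximal coclique -/

namespace IsMaximalCoclique

theorem not_opposite {K V : Type*} [Field K] [AddCommGroup V] [Module K V] {n : ℕ} (hn : 1 ≤ n)
    {F : Set (PGFlag K V n)} (hF : IsMaximalCoclique F) {f g : PGFlag K V n} (hf : f ∈ F)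
    (hg : g ∈ F) : ¬ f.Opposite g := by
  intro h
  have hadj := (flagGraph_adj_iff hn f g).mpr h
  exact hF.prop hf hg hadj.ne hadj

theorem exists_opposite {K V : Type*} [Field K] [AddCommGroup V] [Module K V] {n : ℕ}
    {F : Set (PGFlag K V n)} (hF : IsMaximalCoclique F) {f : PGFlag K V n} (hf : f ∉ F) :
    ∃ g ∈ F, g.Opposite f := by
  by_contra! h
  refine hf (hF.le_of_ge (y := insert f F) ?_ (Set.subset_insert f F) (Set.mem_insert f F))
  intro a ha b hb hab hadj
  obtain rfl | ha := ha
  · obtain rfl | hb := hb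
    · exact hab rfl
    · exact h b hb hadj.2.symm
  · obtain rfl | hb := hb
    · exact h a ha hadj.2
    · exact hF.prop ha hb hab hadj

/-- Either there are few red `(n-1)`-spaces, or all `(n-1)`-spaces through some point are red. -/
theorem ncard_isRedLower_le_or {K V : Type*} [Field K] [Finite K] [AddCommGroup V] [Module K V]
    [Finite V] {n : ℕ} (hn : 2 ≤ n) (hV : Module.finrank K V = 2 * n + 1)
    {F : Set (PGFlag K V n)} (hF : IsMaximalCoclique F) :
    {A : Submodule K V | IsRedLower F A}.ncard ≤ 2 ^ n * Nat.card K ^ (n ^ 2 - 2) ∨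
      ∃ P : Submodule K V, projDim P = 0 ∧
        ∀ A : Submodule K V, projDim A = (n : ℤ) - 1 → P ≤ A → IsRedLower F A := by
  rw [Set.ncard_eq_toFinset_card _ (Set.toFinite _)]
  have hred : ∀ A ∈ (Set.toFinite {A : Submodule K V | IsRedLower F A}).toFinset,
      Module.finrank K A = n ∧ ∀ f : PGFlag K V n, f.lower = A → f ∈ F := fun A hA =>
    (isRedLower_iff hV).mp (by simpa using hA)
  have hint : ∀ A ∈ (Set.toFinite {A : Submodule K V | IsRedLower F A}).toFinset,
      ∀ B ∈ (Set.toFinite {A : Submodule K V | IsRedLower F A}).toFinset, A ⊓ B ≠ ⊥ := by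
    intro A hA B hB hAB
    obtain ⟨g, hgB, hg⟩ :=
      PGFlag.exists_lower_eq_of_inf_eq_bot hV (hred B hB).1 (hred A hA).1 hAB
    obtain ⟨f, hfA, hfg⟩ := PGFlag.exists_opposite_lower_eq hV (hred A hA).1 g hg
    exact hF.not_opposite (by omega) ((hred A hA).2 f hfA) ((hred B hB).2 g hgB) hfg
  obtain h | ⟨P, hP, hPA⟩ := card_le_or_exists_point hn hV (fun A hA => (hred A hA).1) hint
  · exact Or.inl h
  by_cases hall : ∀ A : Submodule K V, projDim A = (n : ℤ) - 1 → P ≤ A → IsRedLower F A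
  · exact Or.inr ⟨P, by simp [projDim, hP], hall⟩
  left
  push Not at hall
  obtain ⟨A, hA, hPle, hnot⟩ := hall
  rw [isRedLower_iff hV, not_and] at hnot
  specialize hnot (projDim_eq_sub_one_iff.mp hA)
  push Not at hnot
  obtain ⟨f, rfl, hf⟩ := hnot
  obtain ⟨g, hgF, hgf⟩ := hF.exists_opposite hf
  refine card_le_of_point_of_inf_ne_bot hn hV hP g.finrank_upper ?_ (fun A hA => (hred A hA).1)
    hPA ?_
  · exact le_bot_iff.mp ((inf_le_inf_right _ hPle).trans hgf.2.le)
  · intro A' hA' hbot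
    obtain ⟨f', hf', hopp⟩ := PGFlag.exists_opposite_lower_eq hV (hred A' hA').1 g hbot
    exact hF.not_opposite (by omega) ((hred A' hA').2 f' hf') hgF hopp

end IsMaximalCoclique

/-! ### Duality -/

theorem finrank_dualAnnihilator {K V : Type*} [Field K] [AddCommGroup V] [Module K V]
    [Module.Finite K V] {a b : ℕ} (hV : Module.finrank K V = a + b) {U : Submodule K V} :
    Module.finrank K U.dualAnnihilator = b ↔ Module.finrank K U = a := by
  have := Subspace.finrank_add_finrank_dualAnnihilator_eq U
  omega

theorem finrank_dualCoannihilator {K V : Type*} [Field K] [AddCommGroup V] [Module K V]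
    [Module.Finite K V] {a b : ℕ} (hV : Module.finrank K V = a + b)
    {U : Submodule K (Module.Dual K V)} :
    Module.finrank K U.dualCoannihilator = b ↔ Module.finrank K U = a := by
  have := Subspace.finrank_add_finrank_dualCoannihilator_eq U
  omega

/-- Complementary pairs of subspaces are complementary in the dual space. -/
theorem dualAnnihilator_inf_dualAnnihilator_eq_bot_iff {K V : Type*} [Field K] [AddCommGroup V]
    [Module K V] [Module.Finite K V] {A B : Submodule K V}
    (h : Module.finrank K A + Module.finrank K B = Module.finrank K V) :
    A.dualAnnihilator ⊓ B.dualAnnihilator = ⊥ ↔ A ⊓ B = ⊥ := by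
  rw [← Submodule.dualAnnihilator_sup_eq, ← Submodule.finrank_eq_zero (R := K),
    ← Submodule.finrank_eq_zero (R := K)]
  have h1 := Submodule.finrank_sup_add_finrank_inf_eq A B
  have h2 := Subspace.finrank_add_finrank_dualAnnihilator_eq (A ⊔ B)
  omega

namespace PGFlag

/-- The correspondence between the flags of a space and those of the dual space. -/
def dualEquiv {K V : Type*} [Field K] [AddCommGroup V] [Module K V] [Module.Finite K V] {n : ℕ}
    (hV : Module.finrank K V = 2 * n + 1) : PGFlag K V n ≃ PGFlag K (Module.Dual K V) n where
  toFun f :=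
    { lower := f.upper.dualAnnihilator
      upper := f.lower.dualAnnihilator
      projDim_lower := projDim_eq_sub_one_iff.mpr
        ((finrank_dualAnnihilator (by omega)).mpr f.finrank_upper)
      projDim_upper := projDim_eq_iff.mpr
        ((finrank_dualAnnihilator (by omega)).mpr f.finrank_lower)
      le := Submodule.dualAnnihilator_anti f.le }
  invFun g :=
    { lower := g.upper.dualCoannihilator
      upper := g.lower.dualCoannihilator
      projDim_lower := projDim_eq_sub_one_iff.mpr
        ((finrank_dualCoannihilator (by omega)).mpr g.finrank_upper)
      projDim_upper := projDim_eq_iff.mpr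
        ((finrank_dualCoannihilator (by omega)).mpr g.finrank_lower)
      le := Submodule.dualCoannihilator_anti g.le }
  left_inv f := PGFlag.ext Subspace.dualAnnihilator_dualCoannihilator_eq
    Subspace.dualAnnihilator_dualCoannihilator_eq
  right_inv g := PGFlag.ext Subspace.dualCoannihilator_dualAnnihilator_eq
    Subspace.dualCoannihilator_dualAnnihilator_eq

theorem dualEquiv_opposite_iff {K V : Type*} [Field K] [AddCommGroup V] [Module K V]
    [Module.Finite K V] {n : ℕ} (hV : Module.finrank K V = 2 * n + 1) {f g : PGFlag K V n} :
    (dualEquiv hV f).Opposite (dualEquiv hV g) ↔ f.Opposite g := by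
  have key : ∀ f g : PGFlag K V n,
      f.upper.dualAnnihilator ⊓ g.lower.dualAnnihilator = ⊥ ↔ g.lower ⊓ f.upper = ⊥ := by
    intro f g
    rw [dualAnnihilator_inf_dualAnnihilator_eq_bot_iff, inf_comm]
    rw [finrank_upper, finrank_lower]
    omega
  exact (and_congr (key f g) (key g f)).trans and_comm

/-- The duality of flags is an isomorphism of the graphs of flags. -/
def dualIso {K V : Type*} [Field K] [AddCommGroup V] [Module K V] [Module.Finite K V] {n : ℕ}
    (hV : Module.finrank K V = 2 * n + 1) :
    flagGraph K V n ≃g flagGraph K (Module.Dual K V) n where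
  toEquiv := dualEquiv hV
  map_rel_iff' := and_congr (dualEquiv hV).injective.ne_iff (dualEquiv_opposite_iff hV)

end PGFlag

theorem SimpleGraph.Iso.isIndepSet_image_iff {α β : Type*} {G : SimpleGraph α}
    {H : SimpleGraph β} (e : G ≃g H) {s : Set α} : H.IsIndepSet (e '' s) ↔ G.IsIndepSet s := by
  simp only [SimpleGraph.IsIndepSet]
  rw [e.injective.injOn.pairwise_image]
  simp [Set.Pairwise, Function.onFun, SimpleGraph.Iso.map_adj_iff]

theorem SimpleGraph.Iso.maximal_isIndepSet_image {α β : Type*} {G : SimpleGraph α}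
    {H : SimpleGraph β} (e : G ≃g H) {s : Set α} (hs : Maximal G.IsIndepSet s) :
    Maximal H.IsIndepSet (e '' s) := by
  refine ⟨e.isIndepSet_image_iff.mpr hs.prop, fun t ht hst => ?_⟩
  have himage : e '' (e ⁻¹' t) = t := Set.image_preimage_eq t e.surjective
  rw [← himage] at ht
  have h := hs.le_of_ge (e.isIndepSet_image_iff.mp ht) (Set.image_subset_iff.mp hst)
  exact himage.symm.le.trans (Set.image_mono h)

theorem isRedLower_image_dualIso_iff {K V : Type*} [Field K] [AddCommGroup V] [Module K V]
    [Module.Finite K V] {n : ℕ} (hV : Module.finrank K V = 2 * n + 1)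
    {F : Set (PGFlag K V n)} {B : Submodule K V} :
    IsRedLower (PGFlag.dualIso hV '' F) B.dualAnnihilator ↔ IsRedUpper F B := by
  rw [IsRedLower, IsRedUpper, projDim_eq_sub_one_iff, projDim_eq_iff,
    finrank_dualAnnihilator (a := n + 1) (by omega)]
  have h : {f ∈ PGFlag.dualIso hV '' F | f.lower = B.dualAnnihilator} =
      PGFlag.dualIso hV '' {f ∈ F | f.upper = B} := by
    ext g
    constructor
    · rintro ⟨⟨f, hf, rfl⟩, hB⟩
      exact ⟨f, ⟨hf, Subspace.orderIsoFiniteDimensional.injective hB⟩, rfl⟩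
    · rintro ⟨f, ⟨hf, rfl⟩, rfl⟩
      exact ⟨⟨f, hf, rfl⟩, rfl⟩
  rw [h, Set.ncard_image_of_injective _ (PGFlag.dualIso hV).injective]

/-- Either there are few red `n`-spaces, or all `n`-spaces of some hyperplane are red. -/
theorem IsMaximalCoclique.ncard_isRedUpper_le_or {K V : Type*} [Field K] [Finite K]
    [AddCommGroup V] [Module K V] [Finite V] {n : ℕ} (hn : 2 ≤ n)
    (hV : Module.finrank K V = 2 * n + 1) {F : Set (PGFlag K V n)} (hF : IsMaximalCoclique F) :
    {B : Submodule K V | IsRedUpper F B}.ncard ≤ 2 ^ n * Nat.card K ^ (n ^ 2 - 2) ∨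
      ∃ H : Submodule K V, projDim H = 2 * (n : ℤ) - 1 ∧
        ∀ B : Submodule K V, projDim B = (n : ℤ) → B ≤ H → IsRedUpper F B := by
  have : Finite (Module.Dual K V) := Module.finite_of_finite K
  have hF' : IsMaximalCoclique (PGFlag.dualIso hV '' F) :=
    (PGFlag.dualIso hV).maximal_isIndepSet_image hF
  obtain h | ⟨P, hP, hPred⟩ :=
    hF'.ncard_isRedLower_le_or hn (Subspace.dual_finrank_eq.trans hV)
  · refine Or.inl (le_trans ?_ h)
    refine Set.ncard_le_ncard_of_injOn Submodule.dualAnnihilator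
      (fun B hB => (isRedLower_image_dualIso_iff hV).mpr hB) ?_ (Set.toFinite _)
    exact (Subspace.orderIsoFiniteDimensional (K := K) (V := V)).injective.injOn
  · refine Or.inr ⟨P.dualCoannihilator, ?_, fun B hB hBP => ?_⟩
    · have h1 := Subspace.finrank_add_finrank_dualCoannihilator_eq P
      unfold projDim at hP ⊢
      omega
    · rw [← isRedLower_image_dualIso_iff hV]
      refine hPred _ ?_ ((Submodule.le_dualAnnihilator_iff_le_dualCoannihilator).mpr hBP)
      rw [projDim_eq_sub_one_iff, finrank_dualAnnihilator (a := n + 1) (by omega)]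
      exact projDim_eq_iff.mp hB

theorem corollaryC (n : ℕ) (hn : 3 ≤ n) :
    ∃ C : ℝ, ∀ (K V : Type*) [Field K] [Finite K] [AddCommGroup V] [Module K V],
      projDim (⊤ : Submodule K V) = 2 * (n : ℤ) →
      ∀ F : Set (PGFlag K V n), IsMaximalCoclique F →
        ((({A : Submodule K V | IsRedLower F A}.ncard : ℕ) : ℝ)
              ≤ C * (Nat.card K : ℝ) ^ (n ^ 2 - 2) ∨
          ∃ P : Submodule K V, projDim P = 0 ∧
            ∀ A : Submodule K V, projDim A = (n : ℤ) - 1 → P ≤ A → IsRedLower F A) ∧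
        ((({B : Submodule K V | IsRedUpper F B}.ncard : ℕ) : ℝ)
              ≤ C * (Nat.card K : ℝ) ^ (n ^ 2 - 2) ∨
          ∃ H : Submodule K V, projDim H = 2 * (n : ℤ) - 1 ∧
            ∀ B : Submodule K V, projDim B = (n : ℤ) → B ≤ H → IsRedUpper F B) := by
  -- Each of the at most `n` counting steps contributes a factor 2.
  refine ⟨2 ^ n, fun K V _ _ _ _ htop F hF => ?_⟩
  have hV : Module.finrank K V = 2 * n + 1 := by
    unfold projDim at htop
    rw [finrank_top] at htop
    omega
  -- `finrank` defaults to 0 in infinite dimension, so a positive value forces finiteness.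
  have : Module.Finite K V := Module.finite_of_finrank_pos (by omega)
  have : Finite V := Module.finite_of_finite K
  refine ⟨(hF.ncard_isRedLower_le_or (by omega) hV).imp_left fun h => ?_,
    (hF.ncard_isRedUpper_le_or (by omega) hV).imp_left fun h => ?_⟩
  · exact_mod_cast h
  · exact_mod_cast h
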